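/- Let $n\ge 3$ and let $P_n$ be the undirected path with vertex set $\{1,\dots,n\}$ and edges $\{k,k+1\}$, $1\le k\le n-1$. Let $\mathrm{IEnd}(P_n)$ be the monoid, under composition of partial maps, of all injective partial maps $f$ from $\{1,\dots,n\}$ to itself such that, for all $u,v$ in the domain of $f$, if $\{u,v\}$ is an edge then the images of $u$ and $v$ form an edge. Let $\mathrm{PAut}(P_n)$ be the submonoid of those $f\in\mathrm{IEnd}(P_n)$ with $f^{-1}\in\mathrm{IEnd}(P_n)$. Maps are composed from left to right. Define - $\tau$: the permutation $k\mapsto n+1-k$ of $\{1,\dots,n\}$; - $\alpha_i$, for $1\le i\le n$: the partial map with domain $\{1,\dots,n\}\setminus\{i\}$ and $k\mapsto k$ for $k<i$, $k\mapsto n+i+1-k$ for $k>i$; - $\beta_i$, for $2\le i\le n-1$: the partial map with domain $\{1,\dots,n\}\setminus\{i\}$ and $k\mapsto k$ for $k<i$, $k\mapsto k-1$ for $k>i$. Let $\mathcal A=\{\tau,\alpha_1,\alpha_2\}$ if $n=3$, and $\mathcal A=\{\tau\}\cup\{\alpha_i : 1\le i\le n-2\}$ if $n\ge 4$; let $\mathcal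 B=\mathcal A\cup\{\beta_i : 2\le i\le\lceil n/2\rceil\}$. Then $\mathcal A$ generates the monoid $\mathrm{PAut}(P_n)$, and $\mathcal B$ generates the monoid $\mathrm{IEnd}(P_n)$; that is, $\langle\mathcal A\rangle=\mathrm{PAut}(P_n)$ and $\langle\mathcal B\rangle=\mathrm{IEnd}(P_n)$. -/

import Mathlib

namespace PartialPath

section Monoid

variable {V : Type*}

/-- The symmetric inverse monoid on `V`: its elements are the partial permutations of `V`
(injective partial maps `V → V`, with `f x = none` when `x` is outside the domain of `f`).
Maps are composed from left to right: `f * g` is "first `f`, then `g`", defined exactly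
where `f` is defined and its value lies in the domain of `g`. -/
instance instMonoidPEquiv : Monoid (V ≃. V) where
  mul f g := f.trans g
  one := PEquiv.refl V
  mul_assoc f g h := PEquiv.trans_assoc f g h
  one_mul f := PEquiv.refl_trans f
  mul_one f := PEquiv.trans_refl f

theorem mul_def (f g : V ≃. V) : f * g = f.trans g := rfl

theorem one_def : (1 : V ≃. V) = PEquiv.refl V := rfl

/-- `f` is a partial endomorphism of the graph `G`: whenever `u` and `v` lie in the domain
of `f` and are adjacent, their images are adjacent. -/
def IsPartialEndo (G : SimpleGraph V) (f : V ≃. V) : Prop :=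
  ∀ u v u' v' : V, u' ∈ f u → v' ∈ f v → G.Adj u v → G.Adj u' v'

theorem IsPartialEndo.one (G : SimpleGraph V) : IsPartialEndo G 1 := by
  intro u v u' v' hu hv h
  rw [one_def, PEquiv.refl_apply, Option.mem_some_iff] at hu hv
  rwa [← hu, ← hv]

theorem IsPartialEndo.mul {G : SimpleGraph V} {f g : V ≃. V}
    (hf : IsPartialEndo G f) (hg : IsPartialEndo G g) : IsPartialEndo G (f * g) := by
  intro u v u' v' hu hv h
  rw [mul_def, PEquiv.mem_trans] at hu hv
  obtain ⟨a, ha, ha'⟩ := hu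
  obtain ⟨b, hb, hb'⟩ := hv
  exact hg a b u' v' ha' hb' (hf u v a b ha hb h)

/-- The monoid of all injective partial endomorphisms of the graph `G`. -/
def IEnd (G : SimpleGraph V) : Submonoid (V ≃. V) where
  carrier := {f | IsPartialEndo G f}
  mul_mem' hf hg := hf.mul hg
  one_mem' := IsPartialEndo.one G

/-- The monoid of all partial automorphisms of the graph `G`: the partial permutations `f`
such that both `f` and its inverse are partial endomorphisms. -/
def PAut (G : SimpleGraph V) : Submonoid (V ≃. V) where
  carrier := {f | IsPartialEndo G f ∧ IsPartialEndo G f.symm}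
  mul_mem' hf hg := ⟨hf.1.mul hg.1, hg.2.mul hf.2⟩
  one_mem' := ⟨IsPartialEndo.one G, IsPartialEndo.one G⟩

end Monoid

/-- The vertices of the path on `n` vertices are the elements of `Fin n`; the vertex `x`
carries the label `x + 1`, so that the labels are `1, …, n`. -/
def label {n : ℕ} (x : Fin n) : ℕ := x.val + 1

/-- The reflection `τ` of the path, which sends the label `k` to `n + 1 - k`. -/
def tau (n : ℕ) : Fin n ≃. Fin n := (Fin.revPerm : Equiv.Perm (Fin n)).toPEquiv

/-- The underlying partial map of `alpha i`. In labels, with `i` itself standing for its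
label: `k ↦ k` for `k < i`, undefined at `k = i`, and `k ↦ n + i + 1 - k` for `k > i`. -/
def alphaFun {n : ℕ} (i x : Fin n) : Option (Fin n) :=
  if x < i then some x
  else if h : i < x then some ⟨n + i.val - x.val, by omega⟩
  else none

/-- The partial permutation `α_i`, with domain and image all vertices except `i`, which fixes
all vertices before `i` and reverses the order of those after `i`. It is its own inverse. -/
def alpha {n : ℕ} (i : Fin n) : Fin n ≃. Fin n where
  toFun := alphaFun i
  invFun := alphaFun i
  inv x y := by
    simp only [alphaFun]
    grind

/-- The partial permutation `β_i`: in labels, `k ↦ k` for `k < i`, undefined at `k = i`, and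
`k ↦ k - 1` for `k > i`. The inverse map fixes `k < i`, sends `i ≤ k < n` to `k + 1`,
and is undefined at `k = n`. -/
def beta {n : ℕ} (i : Fin n) : Fin n ≃. Fin n where
  toFun x :=
    if x < i then some x
    else if i < x then some ⟨x.val - 1, by omega⟩
    else none
  invFun y :=
    if y < i then some y
    else if h : y.val + 1 < n then some ⟨y.val + 1, h⟩
    else none
  inv x y := by
    grind

/-- The set `A`: it is `{τ, α_1, α_2}` for `n = 3`, and `{τ} ∪ {α_i : 1 ≤ i ≤ n - 2}`
for `n ≥ 4`. -/
def genA (n : ℕ) : Set (Fin n ≃. Fin n) :=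
  {tau n} ∪ {f | ∃ i : Fin n, label i ≤ (if n = 3 then 2 else n - 2) ∧ f = alpha i}

/-- The set `B = A ∪ {β_i : 2 ≤ i ≤ ⌈n / 2⌉}`; here `(n + 1) / 2` is the ceiling of `n / 2`. -/
def genB (n : ℕ) : Set (Fin n ≃. Fin n) :=
  genA n ∪ {f | ∃ i : Fin n, 2 ≤ label i ∧ label i ≤ (n + 1) / 2 ∧ f = beta i}

end PartialPath

namespace PartialPath

/-! The maps `τ` and `α_k` form one family of involutive partial maps, the flips: flip `k` reverses
the labels after `k` and is undefined at `k`, with `τ` as the case `k = 0`. Its square is the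
identity off `k`, so a flip can be cancelled on the side where `k` is missing from the domain or
image of `f`. Two flips shift a label `x` to `m + 1` when `m` and `x - 1` are missing: flip `x - 1`
sends `x` to `n`, and flip `m` sends `n` to `m + 1`.

Given `f`, enlarge the initial segment of labels on which it is a partial identity
(`mem_of_fixesUpTo`); at the end, `f` is a partial identity, a product of squares of flips. If `k`
is outside the domain, flips on both sides bring some pair to `k + 1 ↦ k + 1`, unless no image
exceeds `k`. If `k ↦ k` and some `x ≠ k + 1` maps to `k + 1`, then two non-adjacent labels have
adjacent images, so `f` is no partial automorphism; flips bring `x` to `k + 2`, and `β_{k+1}` is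
split off to close the gap at `k + 1`. Thus flips suffice for `PAut`, and flips with all `β_i` for
`IEnd`. It remains to obtain the omitted flips and `β_i` by symmetry under `τ`. -/

variable {n : ℕ}

/-! ### Partial maps as relations on labels -/

/-- The graph of the partial map `f`, read on labels. -/
def Rel (f : Fin n ≃. Fin n) (a b : ℕ) : Prop :=
  ∃ x y : Fin n, label x = a ∧ label y = b ∧ y ∈ f x

theorem Rel.bounds {f : Fin n ≃. Fin n} {a b : ℕ} (h : Rel f a b) :
    1 ≤ a ∧ a ≤ n ∧ 1 ≤ b ∧ b ≤ n := by
  obtain ⟨x, y, rfl, rfl, -⟩ := h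
  simp only [label]
  omega

theorem label_injective : Function.Injective (label (n := n)) := by
  intro x y h
  simp only [label] at h
  omega

theorem exists_label {a : ℕ} (h1 : 1 ≤ a) (h2 : a ≤ n) : ∃ x : Fin n, label x = a :=
  ⟨⟨a - 1, by omega⟩, by simp only [label]; omega⟩

theorem rel_label {f : Fin n ≃. Fin n} {x y : Fin n} : Rel f (label x) (label y) ↔ y ∈ f x := by
  constructor
  · rintro ⟨x', y', hx, hy, h⟩
    rwa [← label_injective hx, ← label_injective hy]
  · exact fun h => ⟨x, y, rfl, rfl, h⟩

theorem Rel.right_unique {f : Fin n ≃. Fin n} {a b c : ℕ} (h : Rel f a b) (h' : Rel f a c) :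
    b = c := by
  obtain ⟨x, y, rfl, rfl, hy⟩ := h
  obtain ⟨x', z, hx, rfl, hz⟩ := h'
  rw [label_injective hx] at hz
  rw [Option.mem_unique hy hz]

theorem rel_symm {f : Fin n ≃. Fin n} {a b : ℕ} : Rel f.symm a b ↔ Rel f b a := by
  constructor
  · rintro ⟨x, y, hx, hy, h⟩
    exact ⟨y, x, hy, hx, f.mem_iff_mem.1 h⟩
  · rintro ⟨x, y, hx, hy, h⟩
    exact ⟨y, x, hy, hx, f.mem_iff_mem.2 h⟩

theorem Rel.left_unique {f : Fin n ≃. Fin n} {a b c : ℕ} (h : Rel f a c) (h' : Rel f b c) :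
    a = b :=
  (rel_symm.2 h).right_unique (rel_symm.2 h')

theorem rel_mul {f g : Fin n ≃. Fin n} {a c : ℕ} :
    Rel (f * g) a c ↔ ∃ b, Rel f a b ∧ Rel g b c := by
  constructor
  · rintro ⟨x, z, rfl, rfl, h⟩
    rw [mul_def, PEquiv.mem_trans] at h
    obtain ⟨y, h1, h2⟩ := h
    exact ⟨label y, rel_label.2 h1, rel_label.2 h2⟩
  · rintro ⟨b, ⟨x, y, rfl, rfl, h1⟩, ⟨y', z, hy, rfl, h2⟩⟩
    rw [label_injective hy] at h2
    rw [rel_label, mul_def, PEquiv.mem_trans]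
    exact ⟨y, h1, h2⟩

theorem rel_one {a b : ℕ} : Rel (1 : Fin n ≃. Fin n) a b ↔ 1 ≤ a ∧ a ≤ n ∧ a = b := by
  constructor
  · intro h
    have hb := h.bounds
    obtain ⟨x, y, rfl, rfl, h⟩ := h
    rw [one_def, PEquiv.refl_apply, Option.mem_some_iff] at h
    exact ⟨hb.1, hb.2.1, by rw [h]⟩
  · rintro ⟨h1, h2, rfl⟩
    obtain ⟨x, rfl⟩ := exists_label h1 h2
    rw [rel_label, one_def, PEquiv.refl_apply, Option.mem_some_iff]

theorem ext_rel {f g : Fin n ≃. Fin n} (h : ∀ a b, Rel f a b ↔ Rel g a b) : f = g := by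
  apply PEquiv.ext
  intro x
  apply Option.ext
  intro y
  have := h (label x) (label y)
  rwa [rel_label, rel_label] at this

theorem isPartialEndo_iff {f : Fin n ≃. Fin n} :
    IsPartialEndo (SimpleGraph.pathGraph n) f ↔
      ∀ a a' b', Rel f a a' → Rel f (a + 1) b' → a' + 1 = b' ∨ b' + 1 = a' := by
  constructor
  · rintro hf a a' b' ⟨x, x', rfl, rfl, hx⟩ ⟨y, y', hy, rfl, hy'⟩
    have := hf x y x' y' hx hy'
    simp only [SimpleGraph.pathGraph_adj, label] at *
    omega
  · intro hf u v u' v' hu hv h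
    rw [SimpleGraph.pathGraph_adj] at h ⊢
    rcases h with h | h
    · have := hf (label u) (label u') (label v') (rel_label.2 hu)
        (by rw [show label u + 1 = label v by simp only [label]; omega]; exact rel_label.2 hv)
      simp only [label] at this
      omega
    · have := hf (label v) (label v') (label u') (rel_label.2 hv)
        (by rw [show label v + 1 = label u by simp only [label]; omega]; exact rel_label.2 hu)
      simp only [label] at this
      omega

theorem mem_IEnd_iff {f : Fin n ≃. Fin n} :
    f ∈ IEnd (SimpleGraph.pathGraph n) ↔
      ∀ a a' b', Rel f a a' → Rel f (a + 1) b' → a' + 1 = b' ∨ b' + 1 = a' :=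
  isPartialEndo_iff

theorem mem_PAut_iff {f : Fin n ≃. Fin n} :
    f ∈ PAut (SimpleGraph.pathGraph n) ↔
      f ∈ IEnd (SimpleGraph.pathGraph n) ∧ f.symm ∈ IEnd (SimpleGraph.pathGraph n) :=
  Iff.rfl

theorem rel_tau {a b : ℕ} :
    Rel (tau n) a b ↔ 1 ≤ a ∧ a ≤ n ∧ 1 ≤ b ∧ b ≤ n ∧ a + b = n + 1 := by
  constructor
  · intro h
    have hb := h.bounds
    obtain ⟨x, y, rfl, rfl, h⟩ := h
    simp only [tau, Equiv.toPEquiv_apply, Option.mem_some_iff, Fin.revPerm_apply] at h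
    subst h
    simp only [label, Fin.val_rev] at *
    omega
  · rintro ⟨h1, h2, h3, h4, h⟩
    obtain ⟨x, rfl⟩ := exists_label h1 h2
    obtain ⟨y, rfl⟩ := exists_label h3 h4
    rw [rel_label]
    simp only [tau, Equiv.toPEquiv_apply, Option.mem_some_iff, Fin.revPerm_apply]
    apply Fin.ext
    simp only [label, Fin.val_rev] at *
    omega

theorem rel_alpha {i : Fin n} {a b : ℕ} :
    Rel (alpha i) a b ↔ 1 ≤ a ∧ a ≤ n ∧ 1 ≤ b ∧ b ≤ n ∧
      (a < label i ∧ b = a ∨ label i < a ∧ a + b = n + label i + 1) := by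
  have key : ∀ x y : Fin n, y ∈ alpha i x ↔
      (label x < label i ∧ label y = label x ∨
        label i < label x ∧ label x + label y = n + label i + 1) := by
    intro x y
    change alphaFun i x = some y ↔ _
    simp only [alphaFun, label]
    split_ifs <;> simp [Fin.ext_iff] <;> omega
  constructor
  · intro h
    obtain ⟨h1, h2, h3, h4⟩ := h.bounds
    obtain ⟨x, y, rfl, rfl, h⟩ := h
    exact ⟨h1, h2, h3, h4, (key x y).1 h⟩
  · rintro ⟨h1, h2, h3, h4, h⟩
    obtain ⟨x, rfl⟩ := exists_label h1 h2
    obtain ⟨y, rfl⟩ := exists_label h3 h4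
    exact rel_label.2 ((key x y).2 h)

theorem rel_beta {i : Fin n} {a b : ℕ} :
    Rel (beta i) a b ↔ 1 ≤ a ∧ a ≤ n ∧ 1 ≤ b ∧ b ≤ n ∧
      (a < label i ∧ b = a ∨ label i < a ∧ a = b + 1) := by
  have key : ∀ x y : Fin n, y ∈ beta i x ↔
      (label x < label i ∧ label y = label x ∨ label i < label x ∧ label x = label y + 1) := by
    intro x y
    change (if x < i then some x else if i < x then some ⟨x.val - 1, _⟩ else none) = some y ↔ _
    simp only [label]
    split_ifs <;> simp [Fin.ext_iff] <;> omega
  constructor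
  · intro h
    obtain ⟨h1, h2, h3, h4⟩ := h.bounds
    obtain ⟨x, y, rfl, rfl, h⟩ := h
    exact ⟨h1, h2, h3, h4, (key x y).1 h⟩
  · rintro ⟨h1, h2, h3, h4, h⟩
    obtain ⟨x, rfl⟩ := exists_label h1 h2
    obtain ⟨y, rfl⟩ := exists_label h3 h4
    exact rel_label.2 ((key x y).2 h)

/-! ### Flips -/

/-- The partial permutation that reverses the labels after `k`, fixes those before `k`, and is
undefined at `k`; it is `tau n` for `k = 0` and the map `alpha` at the label `k` otherwise. -/
def flip (n k : ℕ) : Fin n ≃. Fin n :=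
  if h : 1 ≤ k ∧ k ≤ n then alpha ⟨k - 1, by omega⟩ else tau n

theorem flip_zero : flip n 0 = tau n := by simp [flip]

theorem flip_label (i : Fin n) : flip n (label i) = alpha i := by
  have h : 1 ≤ label i ∧ label i ≤ n := by simp only [label]; omega
  rw [flip, dif_pos h]
  rfl

theorem rel_flip {k a b : ℕ} (hk : k ≤ n) :
    Rel (flip n k) a b ↔ 1 ≤ a ∧ a ≤ n ∧ 1 ≤ b ∧ b ≤ n ∧
      (a < k ∧ b = a ∨ k < a ∧ a + b = n + k + 1) := by
  rcases Nat.eq_zero_or_pos k with rfl | h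
  · rw [flip_zero, rel_tau]
    omega
  · obtain ⟨i, rfl⟩ := exists_label h hk
    rw [flip_label, rel_alpha]

theorem flip_symm {k : ℕ} (hk : k ≤ n) : (flip n k).symm = flip n k := by
  apply ext_rel
  intro a b
  rw [rel_symm, rel_flip hk, rel_flip hk]
  omega

theorem flip_mem_PAut {k : ℕ} (hk : k ≤ n) : flip n k ∈ PAut (SimpleGraph.pathGraph n) := by
  rw [mem_PAut_iff, flip_symm hk, and_self, mem_IEnd_iff]
  intro a a' b' h h'
  rw [rel_flip hk] at h h'
  omega

theorem PAut_le_IEnd : PAut (SimpleGraph.pathGraph n) ≤ IEnd (SimpleGraph.pathGraph n) :=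
  fun _ h => h.1

theorem flip_mem_IEnd {k : ℕ} (hk : k ≤ n) : flip n k ∈ IEnd (SimpleGraph.pathGraph n) :=
  PAut_le_IEnd (flip_mem_PAut hk)

theorem beta_mem_IEnd (i : Fin n) : beta i ∈ IEnd (SimpleGraph.pathGraph n) := by
  rw [mem_IEnd_iff]
  intro a a' b' h h'
  rw [rel_beta] at h h'
  omega

theorem rel_flip_mul {f : Fin n ≃. Fin n} {k a b : ℕ} (hk : k ≤ n) :
    Rel (flip n k * f) a b ↔
      a < k ∧ Rel f a b ∨ k < a ∧ a ≤ n ∧ Rel f (n + k + 1 - a) b := by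
  rw [rel_mul]
  constructor
  · rintro ⟨c, h, hc⟩
    rw [rel_flip hk] at h
    rcases h with ⟨h1, h2, h3, h4, ⟨h, rfl⟩ | ⟨h, h'⟩⟩
    · exact Or.inl ⟨h, hc⟩
    · right
      rw [show n + k + 1 - a = c by omega]
      exact ⟨h, h2, hc⟩
  · rintro (⟨h, hr⟩ | ⟨h, h', hr⟩)
    · have := hr.bounds
      exact ⟨a, (rel_flip hk).2 (by omega), hr⟩
    · have := hr.bounds
      exact ⟨_, (rel_flip hk).2 (by omega), hr⟩

theorem rel_mul_flip {f : Fin n ≃. Fin n} {k a b : ℕ} (hk : k ≤ n) :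
    Rel (f * flip n k) a b ↔
      b < k ∧ Rel f a b ∨ k < b ∧ b ≤ n ∧ Rel f a (n + k + 1 - b) := by
  have h : f * flip n k = (flip n k * f.symm).symm := by
    apply ext_rel
    intro a b
    rw [rel_symm, rel_mul, rel_mul]
    refine exists_congr fun c => ?_
    rw [rel_symm, ← rel_symm (f := flip n k), flip_symm hk, and_comm]
  rw [h, rel_symm, rel_flip_mul hk, rel_symm, rel_symm]

/-- The square of a flip is the identity off `k`, and `k` is not in the domain of `f`. -/
theorem flip_mul_flip_mul {f : Fin n ≃. Fin n} {k : ℕ} (hk : k ≤ n) (hf : ∀ b, ¬ Rel f k b) :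
    flip n k * (flip n k * f) = f := by
  apply ext_rel
  intro a b
  rw [rel_flip_mul hk, rel_flip_mul hk, rel_flip_mul hk]
  constructor
  · rintro (⟨h, ⟨-, h'⟩ | ⟨h', -⟩⟩ | ⟨h, h1, ⟨h', -⟩ | ⟨-, -, h'⟩⟩)
    · exact h'
    · omega
    · omega
    · rwa [show n + k + 1 - (n + k + 1 - a) = a by omega] at h'
  · intro h
    have hb := h.bounds
    rcases lt_trichotomy a k with hak | rfl | hak
    · exact Or.inl ⟨hak, Or.inl ⟨hak, h⟩⟩
    · exact absurd h (hf b)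
    · refine Or.inr ⟨hak, hb.2.1, Or.inr ⟨by omega, by omega, ?_⟩⟩
      rwa [show n + k + 1 - (n + k + 1 - a) = a by omega]

theorem mul_flip_mul_flip {f : Fin n ≃. Fin n} {k : ℕ} (hk : k ≤ n) (hf : ∀ a, ¬ Rel f a k) :
    f * flip n k * flip n k = f := by
  apply ext_rel
  intro a b
  rw [rel_mul_flip hk, rel_mul_flip hk, rel_mul_flip hk]
  constructor
  · rintro (⟨h, ⟨-, h'⟩ | ⟨h', -⟩⟩ | ⟨h, h1, ⟨h', -⟩ | ⟨-, -, h'⟩⟩)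
    · exact h'
    · omega
    · omega
    · rwa [show n + k + 1 - (n + k + 1 - b) = b by omega] at h'
  · intro h
    have hb := h.bounds
    rcases lt_trichotomy b k with hak | rfl | hak
    · exact Or.inl ⟨hak, Or.inl ⟨hak, h⟩⟩
    · exact absurd h (hf a)
    · refine Or.inr ⟨hak, hb.2.2.2, Or.inr ⟨by omega, by omega, ?_⟩⟩
      rwa [show n + k + 1 - (n + k + 1 - b) = b by omega]

/-- `f` restricts to a partial identity on the labels up to `k`, both in its domain and in
its image. -/
def FixesUpTo (k : ℕ) (f : Fin n ≃. Fin n) : Prop :=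
  ∀ a b, a ≤ k ∨ b ≤ k → Rel f a b → a = b

theorem FixesUpTo.flip_mul {f : Fin n ≃. Fin n} {k m : ℕ} (hf : FixesUpTo k f) (hkm : k ≤ m)
    (hm : m ≤ n) : FixesUpTo k (flip n m * f) := by
  intro a b hab h
  rw [rel_flip_mul hm] at h
  rcases h with ⟨-, h⟩ | ⟨h1, h2, h⟩
  · exact hf a b hab h
  · have := hf _ b (by omega) h
    omega

theorem FixesUpTo.mul_flip {f : Fin n ≃. Fin n} {k m : ℕ} (hf : FixesUpTo k f) (hkm : k ≤ m)
    (hm : m ≤ n) : FixesUpTo k (f * flip n m) := by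
  intro a b hab h
  rw [rel_mul_flip hm] at h
  rcases h with ⟨-, h⟩ | ⟨h1, h2, h⟩
  · exact hf a b hab h
  · have := hf a _ (by omega) h
    omega

/-! ### Moves inside a submonoid containing all flips -/

variable {T : Submonoid (Fin n ≃. Fin n)}

theorem mem_of_flip_mul_mem (hT : ∀ k ≤ n, flip n k ∈ T) {f : Fin n ≃. Fin n} {k : ℕ}
    (hk : k ≤ n) (hf : ∀ b, ¬ Rel f k b) (h : flip n k * f ∈ T) : f ∈ T := by
  rw [← flip_mul_flip_mul hk hf]
  exact T.mul_mem (hT k hk) h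

theorem mem_of_mul_flip_mem (hT : ∀ k ≤ n, flip n k ∈ T) {f : Fin n ≃. Fin n} {k : ℕ}
    (hk : k ≤ n) (hf : ∀ a, ¬ Rel f a k) (h : f * flip n k ∈ T) : f ∈ T := by
  rw [← mul_flip_mul_flip hk hf]
  exact T.mul_mem h (hT k hk)

/-- If `m` is outside the domain of `f` and the label `x` after `m` has at most one neighbour in
the domain, then left multiplication by flips moves `x` to `m + 1`. -/
theorem mem_of_forall_moved (hT : ∀ k ≤ n, flip n k ∈ T) {f : Fin n ≃. Fin n} {k m x y : ℕ}
    (hkm : k ≤ m) (hI : f ∈ IEnd (SimpleGraph.pathGraph n)) (hfix : FixesUpTo k f)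
    (hm : ∀ b, ¬ Rel f m b) (hmx : m < x) (hxy : Rel f x y)
    (hx : (∀ b, ¬ Rel f (x - 1) b) ∨ ∀ b, ¬ Rel f (x + 1) b)
    (H : ∀ g : Fin n ≃. Fin n, g ∈ IEnd (SimpleGraph.pathGraph n) →
      (f ∈ PAut (SimpleGraph.pathGraph n) → g ∈ PAut (SimpleGraph.pathGraph n)) →
      FixesUpTo k g → (∀ b, ¬ Rel g m b) → (∀ a b, a < m → Rel f a b → Rel g a b) →
      Rel g (m + 1) y → g ∈ T) : f ∈ T := by
  have hmn : m ≤ n := by have := hxy.bounds; omega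
  have main : ∀ (f' : Fin n ≃. Fin n) (x' : ℕ), f' ∈ IEnd (SimpleGraph.pathGraph n) →
      (f ∈ PAut (SimpleGraph.pathGraph n) → f' ∈ PAut (SimpleGraph.pathGraph n)) →
      FixesUpTo k f' → (∀ b, ¬ Rel f' m b) → (∀ a b, a < m → Rel f a b → Rel f' a b) →
      m < x' → Rel f' x' y → (∀ b, ¬ Rel f' (x' - 1) b) → f' ∈ T := by
    intro f' x' hI hP hfix hm hlt hmx hxy hx
    have hxb := hxy.bounds
    rcases eq_or_ne x' (m + 1) with rfl | hne
    · exact H f' hI hP hfix hm hlt hxy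
    have hxn : x' - 1 ≤ n := by omega
    -- The two flips trace `m + 1 ↦ n ↦ x'`, and neither moves a label below `m`.
    apply mem_of_flip_mul_mem hT hxn hx
    have hm' : ∀ b, ¬ Rel (flip n (x' - 1) * f') m b := by
      intro b hb
      rw [rel_flip_mul hxn] at hb
      rcases hb with ⟨-, h⟩ | ⟨h, -⟩
      · exact hm b h
      · omega
    apply mem_of_flip_mul_mem hT hmn hm'
    apply H
    · exact mul_mem (flip_mem_IEnd hmn) (mul_mem (flip_mem_IEnd hxn) hI)
    · exact fun h => mul_mem (flip_mem_PAut hmn) (mul_mem (flip_mem_PAut hxn) (hP h))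
    · exact (hfix.flip_mul (by omega) hxn).flip_mul hkm hmn
    · intro b hb
      rw [rel_flip_mul hmn] at hb
      omega
    · intro a b ha hab
      rw [rel_flip_mul hmn, rel_flip_mul hxn]
      exact Or.inl ⟨ha, Or.inl ⟨by omega, hlt a b ha hab⟩⟩
    · rw [rel_flip_mul hmn]
      refine Or.inr ⟨by omega, by omega, (rel_flip_mul hxn).2 (Or.inr ⟨by omega, by omega, ?_⟩)⟩
      rwa [show n + (x' - 1) + 1 - (n + m + 1 - (m + 1)) = x' by omega]
  rcases hx with hx | hx
  · exact main f x hI id hfix hm (fun _ _ _ h => h) hmx hxy hx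
  · have hxb := hxy.bounds
    -- Reversing the labels after `m` turns the missing successor of `x` into a missing predecessor.
    apply mem_of_flip_mul_mem hT hmn hm
    apply main _ (n + m + 1 - x)
    · exact mul_mem (flip_mem_IEnd hmn) hI
    · exact fun h => mul_mem (flip_mem_PAut hmn) h
    · exact hfix.flip_mul hkm hmn
    · intro b hb
      rw [rel_flip_mul hmn] at hb
      omega
    · intro a b ha hab
      rw [rel_flip_mul hmn]
      exact Or.inl ⟨ha, hab⟩
    · omega
    · rw [rel_flip_mul hmn]
      refine Or.inr ⟨by omega, by omega, ?_⟩
      rwa [show n + m + 1 - (n + m + 1 - x) = x by omega]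
    · intro b hb
      rw [rel_flip_mul hmn] at hb
      rcases hb with ⟨h, -⟩ | ⟨h, h', hb⟩
      · omega
      · rw [show n + m + 1 - (n + m + 1 - x - 1) = x + 1 by omega] at hb
        exact hx b hb

theorem flip_mul_self_mem (hT : ∀ k ≤ n, flip n k ∈ T) {k : ℕ} (hk : k ≤ n) :
    flip n k * flip n k ∈ T :=
  T.mul_mem (hT k hk) (hT k hk)

theorem rel_flip_mul_self {k a b : ℕ} (hk : k ≤ n) :
    Rel (flip n k * flip n k) a b ↔ 1 ≤ a ∧ a ≤ n ∧ a = b ∧ a ≠ k := by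
  rw [rel_flip_mul hk, rel_flip hk, rel_flip hk]
  omega

/-- A partial identity is a product of squares of flips. -/
theorem mem_of_partial_identity (hT : ∀ k ≤ n, flip n k ∈ T) {f : Fin n ≃. Fin n}
    (hf : ∀ a b, Rel f a b → a = b) : f ∈ T := by
  have main : ∀ m ≤ n, ∃ g ∈ T, ∀ a b, Rel g a b ↔
      1 ≤ a ∧ a ≤ n ∧ a = b ∧ (a ≤ m → Rel f a a) := by
    intro m
    induction m with
    | zero =>
      intro _
      refine ⟨1, T.one_mem, fun a b => ?_⟩
      rw [rel_one]
      constructor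
      · rintro ⟨h1, h2, h3⟩
        exact ⟨h1, h2, h3, fun h => by omega⟩
      · rintro ⟨h1, h2, h3, -⟩
        exact ⟨h1, h2, h3⟩
    | succ m ih =>
      intro hm
      obtain ⟨g, hg, hgr⟩ := ih (by omega)
      by_cases h : Rel f (m + 1) (m + 1)
      · refine ⟨g, hg, fun a b => ?_⟩
        rw [hgr]
        grind
      · refine ⟨flip n (m + 1) * flip n (m + 1) * g,
          T.mul_mem (flip_mul_self_mem hT hm) hg, fun a b => ?_⟩
        rw [rel_mul]
        simp only [rel_flip_mul_self hm, hgr]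
        grind
  obtain ⟨g, hg, hgr⟩ := main n le_rfl
  have : f = g := by
    apply ext_rel
    intro a b
    rw [hgr]
    constructor
    · intro h
      have hb := h.bounds
      have := hf a b h
      subst this
      exact ⟨hb.1, hb.2.1, rfl, fun _ => h⟩
    · rintro ⟨-, h2, rfl, h⟩
      exact h h2
  rw [this]
  exact hg

/-! ### Splitting off a `β` -/

/-- `beta i` followed by its inverse is the identity off `i`; the factor `(beta i).symm * f` is `f`
with the gap at `i` closed. -/
theorem beta_mul_symm_mul (i : Fin n) {f : Fin n ≃. Fin n} (hf : ∀ b, ¬ Rel f (label i) b) :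
    beta i * ((beta i).symm * f) = f := by
  have hi : 1 ≤ label i ∧ label i ≤ n := by simp only [label]; omega
  apply ext_rel
  intro a b
  simp only [rel_mul, rel_symm]
  constructor
  · rintro ⟨c, hac, d, hdc, hdb⟩
    rwa [hac.left_unique hdc]
  · intro h
    have hb := h.bounds
    rcases lt_trichotomy a (label i) with hai | rfl | hai
    · have : Rel (beta i) a a := rel_beta.2 (by omega)
      exact ⟨a, this, a, this, h⟩
    · exact absurd h (hf b)
    · have : Rel (beta i) a (a - 1) := rel_beta.2 (by omega)
      exact ⟨a - 1, this, a, this, h⟩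

theorem rel_beta_symm_mul {i : Fin n} {f : Fin n ≃. Fin n} {a b : ℕ} :
    Rel ((beta i).symm * f) a b ↔
      a < label i ∧ Rel f a b ∨ label i ≤ a ∧ Rel f (a + 1) b := by
  have hi : 1 ≤ label i ∧ label i ≤ n := by simp only [label]; omega
  simp only [rel_mul, rel_symm, rel_beta]
  constructor
  · rintro ⟨c, ⟨h1, h2, h3, h4, ⟨h, rfl⟩ | ⟨h, rfl⟩⟩, hr⟩
    · exact Or.inl ⟨h, hr⟩
    · exact Or.inr ⟨by omega, hr⟩
  · rintro (⟨h, hr⟩ | ⟨h, hr⟩)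
    · have := hr.bounds
      exact ⟨a, by omega, hr⟩
    · have := hr.bounds
      exact ⟨a + 1, by omega, hr⟩

theorem FixesUpTo.succ {f : Fin n ≃. Fin n} {k : ℕ} (hf : FixesUpTo k f)
    (h1 : ∀ b, Rel f (k + 1) b → b = k + 1) (h2 : ∀ a, Rel f a (k + 1) → a = k + 1) :
    FixesUpTo (k + 1) f := by
  intro a b hab h
  by_cases hk : a ≤ k ∨ b ≤ k
  · exact hf a b hk h
  · rcases (show a = k + 1 ∨ b = k + 1 by omega) with rfl | rfl
    · exact (h1 b h).symm
    · exact h2 a h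

theorem FixesUpTo.succ_of_rel {f : Fin n ≃. Fin n} {k : ℕ} (hf : FixesUpTo k f)
    (h : Rel f (k + 1) (k + 1)) : FixesUpTo (k + 1) f :=
  hf.succ (fun _ hb => hb.right_unique h) (fun _ ha => ha.left_unique h)

/-- A label `x` whose image is `k + 1` has at most one neighbour in the domain if `k` is not the
image of a label next to `x`. -/
theorem pred_or_succ_notMem_domain {f : Fin n ≃. Fin n} {x k : ℕ}
    (hI : f ∈ IEnd (SimpleGraph.pathGraph n)) (hxy : Rel f x (k + 1)) (h1 : ¬ Rel f (x - 1) k)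
    (h2 : ¬ Rel f (x + 1) k) :
    (∀ b, ¬ Rel f (x - 1) b) ∨ ∀ b, ¬ Rel f (x + 1) b := by
  have hx := hxy.bounds
  by_contra! hcon
  obtain ⟨⟨b, hb⟩, c, hc⟩ := hcon
  rw [mem_IEnd_iff] at hI
  have e1 := hI (x - 1) b (k + 1) hb (by rwa [show x - 1 + 1 = x by omega])
  have e2 := hI x (k + 1) c hxy hc
  -- Both neighbours of `x` would have to map to `k + 2`, against injectivity.
  have hbk : b ≠ k := by rintro rfl; exact h1 hb
  have hck : c ≠ k := by rintro rfl; exact h2 hc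
  have : b = c := by omega
  subst this
  have := hb.left_unique hc
  omega

/-! ### Induction on the fixed initial segment -/

/-- An injective partial endomorphism of the path lies in every submonoid that contains all flips
and, unless it is a partial automorphism, all the maps `beta i`. -/
theorem mem_of_fixesUpTo (hT : ∀ k ≤ n, flip n k ∈ T) {k : ℕ} (hkn : k ≤ n)
    {f : Fin n ≃. Fin n} (hI : f ∈ IEnd (SimpleGraph.pathGraph n))
    (hP : f ∈ PAut (SimpleGraph.pathGraph n) ∨ ∀ i, beta i ∈ T) (hfix : FixesUpTo k f) :
    f ∈ T := by
  induction hkn using Nat.decreasingInduction generalizing f with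
  | self =>
    exact mem_of_partial_identity hT fun a b h => hfix a b (Or.inl h.bounds.2.1) h
  | of_succ k hk ih =>
    by_cases hkd : ∃ b, Rel f k b
    · obtain ⟨b, hkk⟩ := hkd
      obtain rfl := hfix k b (Or.inl le_rfl) hkk
      have hkb := hkk.bounds
      have hdom : ∀ b, Rel f (k + 1) b → b = k + 1 := by
        intro b hb
        -- The image is `k - 1` or `k + 1`, and `hfix` rules out `k - 1`.
        have := mem_IEnd_iff.1 hI k k b hkk hb
        by_contra hne
        have := hfix (k + 1) b (Or.inr (by omega)) hb
        omega
      by_cases him : ∃ x, Rel f x (k + 1)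
      · obtain ⟨x, hx⟩ := him
        have hxk : k < x := by
          by_contra hle
          have := hfix x (k + 1) (Or.inl (by omega)) hx
          omega
        rcases eq_or_ne x (k + 1) with rfl | hne
        · exact ih hI hP (hfix.succ_of_rel hx)
        have hgap : ∀ b, ¬ Rel f (k + 1) b := by
          intro b hb
          have := hdom b hb
          subst this
          exact hne (hx.left_unique hb)
        have hβ : ∀ i, beta i ∈ T := by
          -- The images `k` and `k + 1` are adjacent, but `x ≥ k + 2` is not adjacent to `k`.
          refine hP.resolve_left fun hA => ?_
          have := mem_IEnd_iff.1 hA.2 k k x (rel_symm.2 hkk) (rel_symm.2 hx)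
          omega
        refine mem_of_forall_moved hT (Nat.le_succ k) hI hfix hgap (by omega) hx
          (pred_or_succ_notMem_domain hI hx ?_ ?_) ?_
        · intro h
          have := h.left_unique hkk
          omega
        · intro h
          have := h.left_unique hkk
          omega
        intro g hgI _ hgfix hgm hglt hgx
        have hgk := hglt k k (by omega) hkk
        obtain ⟨i, hi⟩ := exists_label (n := n) (a := k + 1) (by omega) hk
        rw [← beta_mul_symm_mul i (f := g) (by rwa [hi])]
        refine T.mul_mem (hβ i) (ih ?_ (Or.inr hβ) ?_)
        · rw [mem_IEnd_iff] at hgI ⊢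
          intro a a' b' ha hb
          rw [rel_beta_symm_mul, hi] at ha hb
          rcases ha with ⟨h1, ha⟩ | ⟨h1, ha⟩ <;> rcases hb with ⟨h2, hb⟩ | ⟨h2, hb⟩
          · exact hgI a a' b' ha hb
          -- The only adjacency created by closing the gap: `k, k + 1` map to themselves.
          · obtain rfl : a = k := by omega
            have e1 := ha.right_unique hgk
            have e2 := hb.right_unique hgx
            omega
          · omega
          · exact hgI (a + 1) a' b' ha hb
        · refine FixesUpTo.succ_of_rel ?_ ?_
          · intro a b hab h
            rw [rel_beta_symm_mul, hi] at h
            rcases h with ⟨h, hr⟩ | ⟨h, hr⟩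
            · exact hgfix a b hab hr
            · have := hgfix _ b (by omega) hr
              omega
          · rw [rel_beta_symm_mul, hi]
            exact Or.inr ⟨le_rfl, hgx⟩
      · push Not at him
        exact ih hI hP (hfix.succ hdom fun a ha => absurd ha (him a))
    · push Not at hkd
      have himk : ∀ a, ¬ Rel f a k := by
        intro a ha
        have := hfix a k (Or.inr le_rfl) ha
        subst this
        exact hkd _ ha
      have main : ∀ g : Fin n ≃. Fin n, g ∈ IEnd (SimpleGraph.pathGraph n) →
          (g ∈ PAut (SimpleGraph.pathGraph n) ∨ ∀ i, beta i ∈ T) → FixesUpTo k g →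
          (∀ b, ¬ Rel g k b) → (∀ a, ¬ Rel g a k) → ∀ x, Rel g x (k + 1) → g ∈ T := by
        intro g hI hP hfix hdom him x hx
        have hxk : k < x := by
          by_contra hle
          have := hfix x (k + 1) (Or.inl (by omega)) hx
          omega
        refine mem_of_forall_moved hT le_rfl hI hfix hdom hxk hx
          (pred_or_succ_notMem_domain hI hx (him _) (him _)) ?_
        intro g' hI' hP' hfix' _ _ hx'
        exact ih hI' (hP.imp_left hP') (hfix'.succ_of_rel hx')
      by_cases hex : ∃ y, k < y ∧ ∃ a, Rel f a y
      · classical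
        obtain ⟨hky, a, hay⟩ := Nat.find_spec hex
        have hmin : ∀ z < Nat.find hex, ¬ (k < z ∧ ∃ a, Rel f a z) :=
          fun z hz => Nat.find_min hex hz
        generalize Nat.find hex = y at hky hay hmin
        rcases eq_or_ne y (k + 1) with rfl | hne
        · exact main f hI hP hfix hkd himk a hay
        have hab := hay.bounds
        have hyn : y - 1 ≤ n := by omega
        have hkn : k ≤ n := by omega
        -- By minimality `y - 1` is not an image, so right flips at `y - 1` and `k` move the image
        -- `y` through `n` to `k + 1`.
        apply mem_of_mul_flip_mem hT hyn
          (fun a ha => hmin (y - 1) (by omega) ⟨by omega, a, ha⟩)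
        apply mem_of_mul_flip_mem hT hkn
        · intro a ha
          rw [rel_mul_flip hyn] at ha
          rcases ha with ⟨-, h⟩ | ⟨h, -⟩
          · exact himk a h
          · omega
        refine main _ (mul_mem (mul_mem hI (flip_mem_IEnd hyn)) (flip_mem_IEnd hkn))
          (hP.imp_left fun h => mul_mem (mul_mem h (flip_mem_PAut hyn)) (flip_mem_PAut hkn))
          ((hfix.mul_flip (by omega) hyn).mul_flip le_rfl hkn) ?_ ?_ a ?_
        · intro b hb
          rw [rel_mul] at hb
          obtain ⟨c, hc, -⟩ := hb
          rw [rel_mul] at hc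
          obtain ⟨d, hd, -⟩ := hc
          exact hkd d hd
        · intro b hb
          rw [rel_mul_flip hkn] at hb
          omega
        · rw [rel_mul_flip hkn]
          refine Or.inr ⟨by omega, by omega, (rel_mul_flip hyn).2 (Or.inr ⟨by omega, by omega, ?_⟩)⟩
          rwa [show n + (y - 1) + 1 - (n + k + 1 - (k + 1)) = y by omega]
      · push Not at hex
        refine ih hI hP (hfix.succ ?_ fun a ha => absurd ha (hex (k + 1) (by omega) a))
        intro b hb
        by_cases hbk : b ≤ k
        · have := hfix _ b (Or.inr hbk) hb
          omega
        · exact absurd hb (hex b (by omega) (k + 1))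

/-! ### Recovering the omitted generators -/

/-- For `k ≥ n - 1` at most one label follows `k`, so the flip is just the identity off `k`: the
conjugate by `τ` of the squared flip at `n + 1 - k`. -/
theorem flip_mem_closure_genA (hn : 3 ≤ n) {k : ℕ} (hk : k ≤ n) :
    flip n k ∈ Submonoid.closure (genA n) := by
  have hτ : flip n 0 ∈ Submonoid.closure (genA n) := by
    rw [flip_zero]
    exact Submonoid.subset_closure (Or.inl rfl)
  have hα : ∀ k, 1 ≤ k → k ≤ (if n = 3 then 2 else n - 2) →
      flip n k ∈ Submonoid.closure (genA n) := by
    intro k h1 h2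
    obtain ⟨i, rfl⟩ := exists_label (n := n) h1 (by split_ifs at h2 <;> omega)
    rw [flip_label]
    exact Submonoid.subset_closure (Or.inr ⟨i, h2, rfl⟩)
  have hconj : ∀ k, 1 ≤ k → k ≤ n → flip n (n + 1 - k) ∈ Submonoid.closure (genA n) →
      n ≤ k + 1 → flip n k ∈ Submonoid.closure (genA n) := by
    intro k h1 h2 h3 h4
    have : flip n k = flip n 0 * (flip n (n + 1 - k) * flip n (n + 1 - k)) * flip n 0 := by
      apply ext_rel
      intro a b
      have hk' : n + 1 - k ≤ n := by omega
      simp only [rel_flip h2, rel_mul_flip (Nat.zero_le n), rel_flip_mul (Nat.zero_le n),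
        rel_flip_mul_self hk']
      omega
    rw [this]
    exact mul_mem (mul_mem hτ (mul_mem h3 h3)) hτ
  rcases Nat.eq_zero_or_pos k with rfl | hpos
  · exact hτ
  by_cases h : k ≤ if n = 3 then 2 else n - 2
  · exact hα k hpos h
  · refine hconj k hpos hk (hα _ (by omega) ?_) ?_ <;> split_ifs at h ⊢ <;> omega

/-- `α_1 τ` is the shift `a ↦ a - 1`, which is `β_1`, and `β_n = α_n`. Conjugating `β_{n+1-i}` by
`τ` closes the gap at `i` from below, raising the labels under `i`; the shift then gives `β_i`. -/
theorem beta_mem_closure_genB (hn : 3 ≤ n) (i : Fin n) :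
    beta i ∈ Submonoid.closure (genB n) := by
  have hF : ∀ k ≤ n, flip n k ∈ Submonoid.closure (genB n) := fun k hk =>
    Submonoid.closure_mono Set.subset_union_left (flip_mem_closure_genA hn hk)
  have hi : 1 ≤ label i ∧ label i ≤ n := by simp only [label]; omega
  have h0 : 0 ≤ n := Nat.zero_le n
  have h1 : 1 ≤ n := by omega
  have rel_shift : ∀ a b, Rel (flip n 1 * flip n 0) a b ↔ 1 ≤ b ∧ a ≤ n ∧ a = b + 1 := by
    intro a b
    simp only [rel_mul_flip h0, rel_flip h1]
    omega
  by_cases hi1 : label i = 1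
  · have : beta i = flip n 1 * flip n 0 := by
      apply ext_rel
      intro a b
      rw [rel_shift, rel_beta]
      omega
    rw [this]
    exact mul_mem (hF 1 h1) (hF 0 h0)
  by_cases hin : label i = n
  · have : beta i = flip n n := by
      apply ext_rel
      intro a b
      rw [rel_beta, rel_flip le_rfl]
      omega
    rw [this]
    exact hF n le_rfl
  have hgen : ∀ j : Fin n, 2 ≤ label j → label j ≤ (n + 1) / 2 →
      beta j ∈ Submonoid.closure (genB n) := fun j h2 h3 =>
    Submonoid.subset_closure (Or.inr ⟨j, h2, h3, rfl⟩)
  by_cases hle : label i ≤ (n + 1) / 2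
  · exact hgen i (by omega) hle
  · obtain ⟨j, hj⟩ := exists_label (n := n) (a := n + 1 - label i) (by omega) (by omega)
    have hconj : ∀ a b, Rel (flip n 0 * beta j * flip n 0) a b ↔ 1 ≤ a ∧ a ≤ n ∧
        (a < label i ∧ b = a + 1 ∨ label i < a ∧ b = a) := by
      intro a b
      simp only [rel_mul_flip h0, rel_flip_mul h0, rel_beta, hj]
      omega
    have : beta i = flip n 0 * beta j * flip n 0 * (flip n 1 * flip n 0) := by
      apply ext_rel
      intro a b
      rw [rel_beta, rel_mul]
      simp only [hconj, rel_shift]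
      constructor
      · intro h
        exact ⟨b + 1, by omega⟩
      · rintro ⟨c, h⟩
        omega
    rw [this]
    exact mul_mem (mul_mem (mul_mem (hF 0 h0) (hgen j (by omega) (by omega))) (hF 0 h0))
      (mul_mem (hF 1 h1) (hF 0 h0))

theorem fixesUpTo_zero (f : Fin n ≃. Fin n) : FixesUpTo 0 f := by
  intro a b hab h
  have := h.bounds
  omega

theorem genA_subset_PAut : genA n ⊆ PAut (SimpleGraph.pathGraph n) := by
  rintro f (rfl | ⟨i, -, rfl⟩)
  · rw [← flip_zero]
    exact flip_mem_PAut (Nat.zero_le n)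
  · rw [← flip_label]
    exact flip_mem_PAut (by simp only [label]; omega)

end PartialPath

theorem corollary3 (n : ℕ) (hn : 3 ≤ n) :
    Submonoid.closure (PartialPath.genA n) = PartialPath.PAut (SimpleGraph.pathGraph n) ∧
    Submonoid.closure (PartialPath.genB n) = PartialPath.IEnd (SimpleGraph.pathGraph n) := by
  open PartialPath in
  constructor
  · apply le_antisymm
    · exact (Submonoid.closure_le).2 genA_subset_PAut
    · intro f hf
      exact mem_of_fixesUpTo (fun k hk => flip_mem_closure_genA hn hk) (Nat.zero_le n)
        hf.1 (Or.inl hf) (fixesUpTo_zero f)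
  · apply le_antisymm
    · refine (Submonoid.closure_le).2 ?_
      rintro f (hf | ⟨i, -, -, rfl⟩)
      · exact PAut_le_IEnd (genA_subset_PAut hf)
      · exact beta_mem_IEnd i
    · intro f hf
      exact mem_of_fixesUpTo (fun k hk => Submonoid.closure_mono Set.subset_union_left
        (flip_mem_closure_genA hn hk)) (Nat.zero_le n) hf
        (Or.inr fun i => beta_mem_closure_genB hn i) (fixesUpTo_zero f)
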